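/- **Automata.** Let $k\ge 1$ and let $\Sigma$ be a finite alphabet. A *deterministic $k$-pass automaton* over $\Sigma$ has a finite state set $Q$ with an initial state, a finite stack alphabet $\Gamma\supseteq\Sigma$, and an end-marker $\sharp\notin\Sigma$. On input $w\in\Sigma^*$ it reads $w\sharp$ from left to right $k$ times, starting each pass with empty stack and the first pass in the initial state. Before reading the end-marker its moves are given by a partial function $\delta$ from $\{1,\dots,k\}\times Q\times(\Sigma\cup\{\varepsilon\})\times(\Gamma\cup\{\varepsilon\})$ to $Q\times\Gamma^*$: depending on the pass, the state, the top letter of the stack ($\varepsilon$ if the stack is empty) and either the next input letter, over which the head advances, or $\varepsilon$ (an $\varepsilon$-transition, where the head does not move), it changes state and replaces the top letter by a word. There is no $\varepsilon$-transition on an empty stack. For each pass, state and top of stack there is either an $\varepsilon$-transition and no transition reading an input letter, or no $\varepsilon$-transition and a transition for every input letter. When the head is on $\sharp$ and no $\varepsilon$-transition applies, the automaton reads $\sharp$: on a pass $j<k$ the pass, the state and the top of the stack determine the state in which the next pass begins (with the head reset and the stack emptied), and on pass $k$ the state and the top of the stack determine whether it accepts or rejects. A *nondeterministic $k$-pass automaton*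 is defined in the same way, except that $\delta$ takes finite subsets of $Q\times\Gamma^*$ as values (possibly empty; $\varepsilon$-transitions are still not allowed on an empty stack, and there are no other restrictions), the end-marker on a pass $j<k$ gives a subset of $Q$ from which the next state is chosen, and the end-marker may be read whenever the head is on it; it accepts $w$ if some computation on $w\sharp$ accepts. A language is *deterministic* (respectively *nondeterministic*) *multipass* if it is the set of words accepted by some deterministic (respectively nondeterministic) $k$-pass automaton, for some $k\ge1$. **Groups.** The word problem of a group $G$ relative to a finite generating set $X$ is the language of all words over $X\cup X^{-1}$ that represent the identity of $G$. Let $\mathcal{BDG}$ (respectively $\mathcal{PG}$) be the class of all finitely generated groups whose word problem, relative to some finite generating set, is a deterministic (respectively nondeterministic) multipass language. **Theorem.** Let $G$ be a group in $\mathcal{BDG}$ (respectively $\mathcal{PG}$), let $S$ be a subgroup of finite index in $G$, and let $\varphi\colon G\to G$ be an automorphism of finite order with $\varphi(S)=S$. Then the HNN-extension $$H=\langle G,t;\ tst^{-1}=\varphi(s),\ s\in S\rangle$$ is again in $\mathcal{BDG}$ (respectively $\mathcal{PG}$). -/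

import Mathlib

/-- A configuration of an automaton with `m + 1` passes: either it is running, on pass `j`, in
state `q`, with `u` the part of the input which is still unread on this pass (`u = []` means that
the head is on the end-marker) and with stack `s` (the head of the list is the top of the stack);
or it has halted, in the accepting state (`true`) or in the other halting state (`false`). -/
inductive MultipassConfig (A Q Γ : Type*) (m : ℕ) where
  | run (j : Fin (m + 1)) (q : Q) (u : List A) (s : List Γ) : MultipassConfig A Q Γ m
  | halt (verdict : Bool) : MultipassConfig A Q Γ m

/-- A deterministic `(m + 1)`-pass automaton with input alphabet `A`, state set `Q` and stack
alphabet `Γ`. In `δ j q σ γ`, `σ = none` means an `ε`-transition and `γ = none` means that the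
stack is empty; the value `some (q', ζ)` means: go to `q'` and replace the top letter `γ` by the
word `ζ`, written with its top letter first. The value `none` means that there is no
transition. -/
structure DetMultipassAutomaton (A Q Γ : Type*) (m : ℕ) where
  /-- the stack alphabet contains the input alphabet -/
  inputToStack : A ↪ Γ
  /-- the initial state -/
  start : Q
  /-- the transitions that do not read the end-marker -/
  δ : Fin (m + 1) → Q → Option A → Option Γ → Option (Q × List Γ)
  /-- the transitions reading the end-marker on a nonfinal pass -/
  nextPass : Fin m → Q → Option Γ → Q
  /-- the transitions reading the end-marker on the final pass -/
  final : Q → Option Γ → Bool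
  /-- no `ε`-transition on an empty stack -/
  no_eps_of_empty : ∀ j q, δ j q none none = none
  /-- an `ε`-transition excludes all transitions that read a letter -/
  deterministic : ∀ j q γ, δ j q none γ ≠ none → ∀ a, δ j q (some a) γ = none
  /-- there is always either an `ε`-transition or a transition that reads the input letter -/
  total : ∀ j q γ, δ j q none γ ≠ none ∨ ∀ a, δ j q (some a) γ ≠ none

namespace DetMultipassAutomaton

variable {A Q Γ : Type*} {m : ℕ}

/-- One move of `M` on input `w`. The end-marker is read only if no `ε`-transition applies; on
reading it on a nonfinal pass the head is reset and the stack is emptied. -/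
inductive Step (M : DetMultipassAutomaton A Q Γ m) (w : List A) :
    MultipassConfig A Q Γ m → MultipassConfig A Q Γ m → Prop
  | read (j : Fin (m + 1)) (q q' : Q) (a : A) (u : List A) (s ζ : List Γ)
      (h : M.δ j q (some a) s.head? = some (q', ζ)) :
      Step M w (.run j q (a :: u) s) (.run j q' u (ζ ++ s.tail))
  | eps (j : Fin (m + 1)) (q q' : Q) (u : List A) (s ζ : List Γ)
      (h : M.δ j q none s.head? = some (q', ζ)) :
      Step M w (.run j q u s) (.run j q' u (ζ ++ s.tail))
  | nextPass (j : Fin m) (q : Q) (s : List Γ)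
      (h : M.δ j.castSucc q none s.head? = none) :
      Step M w (.run j.castSucc q [] s) (.run j.succ (M.nextPass j q s.head?) w [])
  | final (q : Q) (s : List Γ)
      (h : M.δ (Fin.last m) q none s.head? = none) :
      Step M w (.run (Fin.last m) q [] s) (.halt (M.final q s.head?))

/-- The language accepted by `M`: the words on which `M`, started on its first pass in the initial
state with empty stack, halts in the accepting state. -/
def language (M : DetMultipassAutomaton A Q Γ m) : Language A :=
  {w | Relation.ReflTransGen (M.Step w) (.run 0 M.start w []) (.halt true)}

end DetMultipassAutomaton

/-- A nondeterministic `(m + 1)`-pass automaton with input alphabet `A`, state set `Q` and stack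
alphabet `Γ`; the conventions are those of `DetMultipassAutomaton`. -/
structure NondetMultipassAutomaton (A Q Γ : Type*) (m : ℕ) where
  /-- the stack alphabet contains the input alphabet -/
  inputToStack : A ↪ Γ
  /-- the initial state -/
  start : Q
  /-- the transitions that do not read the end-marker -/
  δ : Fin (m + 1) → Q → Option A → Option Γ → Set (Q × List Γ)
  /-- the transitions reading the end-marker on a nonfinal pass -/
  nextPass : Fin m → Q → Option Γ → Set Q
  /-- the transitions reading the end-marker on the final pass -/
  final : Q → Option Γ → Bool
  /-- there are finitely many choices -/
  finite_δ : ∀ j q σ γ, (δ j q σ γ).Finite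
  /-- no `ε`-transition on an empty stack -/
  no_eps_of_empty : ∀ j q, δ j q none none = ∅

namespace NondetMultipassAutomaton

variable {A Q Γ : Type*} {m : ℕ}

/-- One possible move of `M` on input `w`. -/
inductive Step (M : NondetMultipassAutomaton A Q Γ m) (w : List A) :
    MultipassConfig A Q Γ m → MultipassConfig A Q Γ m → Prop
  | read (j : Fin (m + 1)) (q q' : Q) (a : A) (u : List A) (s ζ : List Γ)
      (h : (q', ζ) ∈ M.δ j q (some a) s.head?) :
      Step M w (.run j q (a :: u) s) (.run j q' u (ζ ++ s.tail))
  | eps (j : Fin (m + 1)) (q q' : Q) (u : List A) (s ζ : List Γ)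
      (h : (q', ζ) ∈ M.δ j q none s.head?) :
      Step M w (.run j q u s) (.run j q' u (ζ ++ s.tail))
  | nextPass (j : Fin m) (q q' : Q) (s : List Γ)
      (h : q' ∈ M.nextPass j q s.head?) :
      Step M w (.run j.castSucc q [] s) (.run j.succ q' w [])
  | final (q : Q) (s : List Γ) :
      Step M w (.run (Fin.last m) q [] s) (.halt (M.final q s.head?))

/-- The language accepted by `M`: the words on which some computation of `M`, started on the first
pass in the initial state with empty stack, halts in the accepting state. -/
def language (M : NondetMultipassAutomaton A Q Γ m) : Language A :=
  {w | Relation.ReflTransGen (M.Step w) (.run 0 M.start w []) (.halt true)}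

end NondetMultipassAutomaton

/-- Deterministic multipass languages. -/
def IsDetMultipass {A : Type*} (L : Language A) : Prop :=
  ∃ (m : ℕ) (Q Γ : Type) (_ : Finite Q) (_ : Finite Γ) (M : DetMultipassAutomaton A Q Γ m),
    M.language = L

/-- Nondeterministic multipass languages. -/
def IsNondetMultipass {A : Type*} (L : Language A) : Prop :=
  ∃ (m : ℕ) (Q Γ : Type) (_ : Finite Q) (_ : Finite Γ) (M : NondetMultipassAutomaton A Q Γ m),
    M.language = L

/-- The word problem of a group `G` relative to generators `x i`: the set of all words over the
letters `x i` (written `(i, true)`) and `(x i)⁻¹` (written `(i, false)`) whose value in `G`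
is `1`. -/
def wordProblem {G : Type*} [Group G] {X : Type*} (x : X → G) : Language (X × Bool) :=
  {w | (w.map fun p => if p.2 then x p.1 else (x p.1)⁻¹).prod = 1}

/-- The class of finitely generated groups with deterministic multipass word problem. -/
def InBDG (G : Type*) [Group G] : Prop :=
  ∃ (n : ℕ) (x : Fin n → G),
    Subgroup.closure (Set.range x) = ⊤ ∧ IsDetMultipass (wordProblem x)

/-- The class of finitely generated groups with nondeterministic multipass (equivalently,
poly-context-free) word problem. -/
def InPG (G : Type*) [Group G] : Prop :=
  ∃ (n : ℕ) (x : Fin n → G),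
    Subgroup.closure (Set.range x) = ⊤ ∧ IsNondetMultipass (wordProblem x)

/-- The HNN-extension `⟨G, t; t s t⁻¹ = φ s, s ∈ S⟩` for an automorphism `φ` of `G`. -/
abbrev HNNOfAut {G : Type*} [Group G] (S : Subgroup G) (φ : G ≃* G) : Type _ :=
  HNNExtension G S (S.map (φ : G →* G)) (φ.subgroupMap S)

/-! The relations of `H` hold in `G ⋊ ⟨φ⟩` when `t` is sent to `φ`, so there is a homomorphism `θ`
from `H` to this group which is injective on `G`. Hence a word represents `1` in `H` if and only if
its value lies in `G` and its image under `θ` is trivial.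

The second condition is a finite-state matter relative to the word problem of `G`: since `φ` has
finite order, a finite transducer tracks the `⟨φ⟩`-component and writes the `G`-component as a word
in the generators of `G` (`preimage_semidirectTransducer`). The first condition is decided by
Britton reduction on a stack. The normal core of `S` is `φ`-invariant and of finite index, and it
suffices to store the elements of `G` modulo this core, since it lies in `S` and so membership in
`S` remains visible (`represents_t_zpow_mul`). This gives a deterministic pushdown automaton without
`ε`-moves.

It remains to close both language classes under preimages by transducers (`language_transduce`) and
under intersection with such pushdown languages, by one additional pass (`language_prepend`). -/

/-! ### Deterministic automata as nondeterministic automata without choices -/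

namespace NondetMultipassAutomaton

variable {A Q Γ : Type*} {m : ℕ}

/-- The nondeterministic automata that are deterministic automata in disguise. -/
structure IsDet (M : NondetMultipassAutomaton A Q Γ m) : Prop where
  δ_subsingleton : ∀ j q σ γ, (M.δ j q σ γ).Subsingleton
  deterministic : ∀ j q γ, (M.δ j q none γ).Nonempty → ∀ a, M.δ j q (some a) γ = ∅
  total : ∀ j q γ, (M.δ j q none γ).Nonempty ∨ ∀ a, (M.δ j q (some a) γ).Nonempty
  nextPass_subsingleton : ∀ j q γ, (M.nextPass j q γ).Subsingleton
  -- A nondeterministic automaton may read the end-marker at any time. This field and the next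
  -- encode the priority of `ε`-transitions; on the final pass only acceptance needs care, since a
  -- rejecting halt never affects the language.
  nextPass_nonempty_iff : ∀ j q γ, (M.nextPass j q γ).Nonempty ↔ M.δ j.castSucc q none γ = ∅
  final_eps : ∀ q γ, M.final q γ = true → M.δ (Fin.last m) q none γ = ∅

/-- A backward-invariant predicate of configurations holds of all accepting ones. -/
theorem accepting_induction (M : NondetMultipassAutomaton A Q Γ m) {w : List A}
    {P : MultipassConfig A Q Γ m → Prop} (halt : P (.halt true))
    (step : ∀ c c', M.Step w c c' → P c' → P c) {c : MultipassConfig A Q Γ m}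
    (h : Relation.ReflTransGen (M.Step w) c (.halt true)) : P c := by
  induction h using Relation.ReflTransGen.head_induction_on with
  | refl => exact halt
  | head h _ ih => exact step _ _ h ih

end NondetMultipassAutomaton

namespace DetMultipassAutomaton

variable {A Q Γ : Type*} {m : ℕ}

/-- A deterministic automaton as a nondeterministic one. -/
def toNondet (M : DetMultipassAutomaton A Q Γ m) : NondetMultipassAutomaton A Q Γ m where
  inputToStack := M.inputToStack
  start := M.start
  δ j q σ γ := {p | M.δ j q σ γ = some p}
  nextPass j q γ := {q' | M.δ j.castSucc q none γ = none ∧ M.nextPass j q γ = q'}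
  final q γ := M.final q γ && (M.δ (Fin.last m) q none γ).isNone
  finite_δ j q σ γ := Set.Subsingleton.finite fun p hp p' hp' =>
    Option.some.inj (hp.symm.trans hp')
  no_eps_of_empty j q := by simp [M.no_eps_of_empty]

theorem toNondet_isDet (M : DetMultipassAutomaton A Q Γ m) : M.toNondet.IsDet := by
  have key : ∀ j q σ γ, (M.toNondet.δ j q σ γ).Nonempty ↔ M.δ j q σ γ ≠ none := fun j q σ γ =>
    Option.ne_none_iff_exists'.symm
  have key' : ∀ j q σ γ, M.toNondet.δ j q σ γ = ∅ ↔ M.δ j q σ γ = none := fun j q σ γ => by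
    rw [← Set.not_nonempty_iff_eq_empty, key, not_not]
  refine ⟨fun j q σ γ p hp p' hp' => Option.some.inj (hp.symm.trans hp'), ?_, ?_, ?_, ?_, ?_⟩
  · intro j q γ
    simp only [key, key']
    exact M.deterministic j q γ
  · intro j q γ
    simp only [key]
    exact M.total j q γ
  · rintro j q γ _ ⟨_, rfl⟩ _ ⟨_, rfl⟩
    rfl
  · intro j q γ
    rw [key']
    exact ⟨fun ⟨_, h⟩ => h.1, fun h => ⟨_, h, rfl⟩⟩
  · intro q γ h
    rw [key']
    simpa using (Bool.and_eq_true_iff.1 h).2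

theorem language_toNondet (M : DetMultipassAutomaton A Q Γ m) :
    M.toNondet.language = M.language := by
  ext w
  constructor
  · refine M.toNondet.accepting_induction
      (P := fun c => Relation.ReflTransGen (M.Step w) c (.halt true)) .refl ?_
    intro c c' h ih
    cases h with
    | read j q q' a u s ζ h => exact .head (.read _ _ _ _ _ _ _ h) ih
    | eps j q q' u s ζ h => exact .head (.eps _ _ _ _ _ _ h) ih
    | nextPass j q q' s h =>
      obtain ⟨h, rfl⟩ := h
      exact .head (.nextPass _ _ _ h) ih
    | final q s =>
      -- A halted configuration has no further move, so the verdict just reached is already `true`.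
      rcases Relation.ReflTransGen.cases_head ih with h | ⟨_, h, _⟩
      · have h : (M.final q s.head? && (M.δ (Fin.last m) q none s.head?).isNone) = true := by
          simpa [toNondet] using h
        rw [Bool.and_eq_true_iff] at h
        rw [← h.1]
        exact .single (.final _ _ (by simpa using h.2))
      · cases h
  · intro h
    change Relation.ReflTransGen (M.toNondet.Step w) _ _
    refine Relation.ReflTransGen.mono (r := M.Step w) ?_ _ _ h
    intro c c' h
    cases h with
    | read j q q' a u s ζ h => exact .read _ _ _ _ _ _ _ h
    | eps j q q' u s ζ h => exact .eps _ _ _ _ _ _ h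
    | nextPass j q s h => exact .nextPass _ _ _ _ ⟨h, rfl⟩
    | final q s h =>
      have := NondetMultipassAutomaton.Step.final (M := M.toNondet) (w := w) q s
      simpa [toNondet, h] using this

end DetMultipassAutomaton

namespace NondetMultipassAutomaton

variable {A Q Γ : Type*} {m : ℕ}

open Classical in
/-- The deterministic automaton given by a nondeterministic automaton that makes no choices. -/
noncomputable def toDet (M : NondetMultipassAutomaton A Q Γ m) (hM : M.IsDet) :
    DetMultipassAutomaton A Q Γ m where
  inputToStack := M.inputToStack
  start := M.start
  δ j q σ γ := if h : (M.δ j q σ γ).Nonempty then some h.some else none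
  -- The default `q` is never used in a run: by `nextPass_nonempty_iff` it occurs only where an
  -- `ε`-transition prevents reading the end-marker.
  nextPass j q γ := if h : (M.nextPass j q γ).Nonempty then h.some else q
  final := M.final
  no_eps_of_empty j q := by simp [M.no_eps_of_empty]
  deterministic j q γ h a := by
    have h : (M.δ j q none γ).Nonempty := by by_contra h'; simp [h'] at h
    simp [hM.deterministic j q γ h a]
  total j q γ := (hM.total j q γ).imp (fun h => by simp [h]) (fun h a => by simp [h a])

theorem toDet_δ_eq_some (M : NondetMultipassAutomaton A Q Γ m) (hM : M.IsDet) {j q σ γ p} :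
    (M.toDet hM).δ j q σ γ = some p ↔ p ∈ M.δ j q σ γ := by
  by_cases h : (M.δ j q σ γ).Nonempty
  · simp only [toDet, h, dif_pos, Option.some.injEq]
    exact ⟨fun e => e ▸ h.some_mem, fun hp => hM.δ_subsingleton _ _ _ _ h.some_mem hp⟩
  · simp only [toDet, h, dif_neg, not_false_eq_true, reduceCtorEq, false_iff]
    exact fun hp => h ⟨p, hp⟩

theorem toDet_δ_eq_none (M : NondetMultipassAutomaton A Q Γ m) (hM : M.IsDet) {j q σ γ} :
    (M.toDet hM).δ j q σ γ = none ↔ M.δ j q σ γ = ∅ := by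
  rw [Option.eq_none_iff_forall_ne_some, Set.eq_empty_iff_forall_notMem]
  simp only [ne_eq, toDet_δ_eq_some]

theorem toDet_nextPass_eq (M : NondetMultipassAutomaton A Q Γ m) (hM : M.IsDet) {j q γ q'}
    (h : q' ∈ M.nextPass j q γ) : (M.toDet hM).nextPass j q γ = q' := by
  have h' : (M.nextPass j q γ).Nonempty := ⟨_, h⟩
  simp only [toDet, h', dif_pos]
  exact hM.nextPass_subsingleton _ _ _ h'.some_mem h

/-- Only accepting runs correspond: a rejecting halt that competes with an `ε`-transition has no
counterpart in `toDet`. -/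
theorem language_toDet (M : NondetMultipassAutomaton A Q Γ m) (hM : M.IsDet) :
    (M.toDet hM).language = M.language := by
  ext w
  constructor
  · intro h
    change Relation.ReflTransGen (M.Step w) _ _
    refine Relation.ReflTransGen.mono (r := (M.toDet hM).Step w) ?_ _ _ h
    intro c c' h
    cases h with
    | read j q q' a u s ζ h => exact .read _ _ _ _ _ _ _ ((toDet_δ_eq_some M hM).1 h)
    | eps j q q' u s ζ h => exact .eps _ _ _ _ _ _ ((toDet_δ_eq_some M hM).1 h)
    | nextPass j q s h =>
      obtain ⟨q', h⟩ := (hM.nextPass_nonempty_iff _ _ _).2 ((toDet_δ_eq_none M hM).1 h)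
      rw [toDet_nextPass_eq M hM h]
      exact .nextPass _ _ _ _ h
    | final q s h => exact .final q s
  · refine M.accepting_induction
      (P := fun c => Relation.ReflTransGen ((M.toDet hM).Step w) c (.halt true)) .refl ?_
    intro c c' h ih
    cases h with
    | read j q q' a u s ζ h => exact .head (.read _ _ _ _ _ _ _ ((toDet_δ_eq_some M hM).2 h)) ih
    | eps j q q' u s ζ h => exact .head (.eps _ _ _ _ _ _ ((toDet_δ_eq_some M hM).2 h)) ih
    | nextPass j q q' s h =>
      rw [← toDet_nextPass_eq M hM h] at ih
      refine .head (.nextPass _ _ _ ?_) ih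
      exact (toDet_δ_eq_none M hM).2 ((hM.nextPass_nonempty_iff _ _ _).1 ⟨_, h⟩)
    | final q s =>
      rcases Relation.ReflTransGen.cases_head ih with h | ⟨_, h, _⟩
      · have h : M.final q s.head? = true := by simpa using h
        have := DetMultipassAutomaton.Step.final (M := M.toDet hM) (w := w) q s
          ((toDet_δ_eq_none M hM).2 (hM.final_eps _ _ h))
        rw [show (M.toDet hM).final q s.head? = true from h] at this
        exact .single this
      · cases h

end NondetMultipassAutomaton

/-- Each closure construction can thus be made once, for nondeterministic automata, followed by a
check that `IsDet` is preserved. -/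
theorem isDetMultipass_iff {A : Type*} (L : Language A) :
    IsDetMultipass L ↔
      ∃ (m : ℕ) (Q Γ : Type) (_ : Finite Q) (_ : Finite Γ) (M : NondetMultipassAutomaton A Q Γ m),
        M.IsDet ∧ M.language = L := by
  constructor
  · rintro ⟨m, Q, Γ, hQ, hΓ, M, rfl⟩
    exact ⟨m, Q, Γ, hQ, hΓ, M.toNondet, M.toNondet_isDet, M.language_toNondet⟩
  · rintro ⟨m, Q, Γ, hQ, hΓ, M, hM, rfl⟩
    exact ⟨m, Q, Γ, hQ, hΓ, M.toDet hM, M.language_toDet hM⟩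

/-! ### Preimages under finite-state transducers -/

/-- A deterministic finite-state transducer from words over `A` to words over `B`, with state
set `P`. -/
structure Transducer (A B P : Type*) where
  /-- the initial state -/
  start : P
  /-- the transition function -/
  step : P → A → P
  /-- the word written on reading a letter -/
  out : P → A → List B
  /-- the accepting states -/
  accept : P → Bool

namespace Transducer

variable {A B P : Type*}

/-- The state reached from `p` after reading a word. -/
def run (T : Transducer A B P) (p : P) (u : List A) : P := u.foldl T.step p

/-- The word written on reading a word, starting from the state `p`. -/
def output (T : Transducer A B P) : P → List A → List B
  | _, [] => []
  | p, a :: u => T.out p a ++ T.output (T.step p a) u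

/-- The words which the transducer accepts and which it maps into the language `L`. -/
def preimage (T : Transducer A B P) (L : Language B) : Language A :=
  {w | T.accept (T.run T.start w) = true ∧ T.output T.start w ∈ L}

end Transducer

namespace NondetMultipassAutomaton

variable {A B P Q Γ : Type*} {m n : ℕ}

/-- The stack letter that represents the top of a stack of the simulated automaton. The letter
`Sum.inl none` marks the bottom of the stack. -/
def decodeTop (γ : Option (Option Γ ⊕ A)) : Option Γ :=
  γ.bind fun c => c.elim id fun _ => none

/-- The word that replaces the top letter `γ` when the simulated automaton writes `ζ`. -/
def encodeWord (γ : Option (Option Γ ⊕ A)) (ζ : List Γ) : List (Option Γ ⊕ A) :=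
  -- If the simulated stack is empty, the replaced letter may be the bottom marker, so the marker is
  -- written again below `ζ`.
  ζ.map (fun c => Sum.inl (some c)) ++ if decodeTop γ = none then [Sum.inl none] else []

/-- The contents of the buffer; an empty stack indicates that it is empty. -/
def activeBuffer (γ : Option (Option Γ ⊕ A)) (b : {b : List B // b.length ≤ n}) :
    {b : List B // b.length ≤ n} :=
  -- On a truly empty stack no `ε`-transition is allowed, so a buffered letter could not be consumed
  -- there.
  γ.elim ⟨[], Nat.zero_le n⟩ fun _ => b

/-- The moves in which the simulated automaton reads the first letter of the buffer. -/
def consume (M : NondetMultipassAutomaton B Q Γ m) (j : Fin (m + 1)) (p : P) (q : Q)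
    (γ : Option (Option Γ ⊕ A)) :
    {b : List B // b.length ≤ n} → Set ((P × {b : List B // b.length ≤ n} × Q) ×
      List (Option Γ ⊕ A))
  | ⟨[], _⟩ => ∅
  | ⟨x :: b, h⟩ => (fun r : Q × List Γ => ((p, ⟨b, (Nat.le_succ _).trans h⟩, r.1),
      encodeWord γ r.2)) '' M.δ j q (some x) (decodeTop γ)

theorem finite_consume (M : NondetMultipassAutomaton B Q Γ m) (j : Fin (m + 1)) (p : P) (q : Q)
    (γ : Option (Option Γ ⊕ A)) (b : {b : List B // b.length ≤ n}) :
    (M.consume j p q γ b).Finite := by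
  rcases b with ⟨_ | ⟨x, b⟩, h⟩
  · exact Set.finite_empty
  · exact (M.finite_δ _ _ _ _).image _

/-- The automaton which runs `M` on the output of the transducer `T`. A word written by `T` is
kept in a buffer until `M` has read it. -/
def transduce (M : NondetMultipassAutomaton B Q Γ m) (T : Transducer A B P)
    (hT : ∀ p a, (T.out p a).length ≤ n) :
    NondetMultipassAutomaton A (P × {b : List B // b.length ≤ n} × Q) (Option Γ ⊕ A) m where
  inputToStack := ⟨Sum.inr, Sum.inr_injective⟩
  start := (T.start, ⟨[], Nat.zero_le n⟩, M.start)
  δ j s σ γ := match σ with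
    | none => (fun r : Q × List Γ => ((s.1, s.2.1, r.1), encodeWord γ r.2)) ''
        M.δ j s.2.2 none (decodeTop γ) ∪ M.consume j s.1 s.2.2 γ (activeBuffer γ s.2.1)
    | some a => {r | (activeBuffer γ s.2.1).1 = [] ∧
        -- For deterministic `M`, loading must not compete with an `ε`-move. Otherwise `M` may
        -- prefer to read although an `ε`-move exists, so the restriction has to disappear.
        (M.IsDet → M.δ j s.2.2 none (decodeTop γ) = ∅) ∧
        -- The top letter is put back; on an empty stack the bottom marker is created, so that the
        -- buffer can then be consumed by `ε`-moves.
        r = ((T.step s.1 a, ⟨T.out s.1 a, hT s.1 a⟩, s.2.2), [γ.getD (Sum.inl none)])}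
  -- Every pass of `M` has to see the whole output, so the buffer must be used up and `T` is
  -- restarted.
  nextPass j s γ := {s' | (activeBuffer γ s.2.1).1 = [] ∧ ∃ q' ∈ M.nextPass j s.2.2 (decodeTop γ),
    s' = (T.start, ⟨[], Nat.zero_le n⟩, q')}
  final s γ := (activeBuffer γ s.2.1).1.isEmpty && T.accept s.1 && M.final s.2.2 (decodeTop γ)
  finite_δ j s σ γ := by
    rcases σ with _ | a
    · exact ((M.finite_δ _ _ _ _).image _).union (M.finite_consume _ _ _ _ _)
    · exact Set.Subsingleton.finite fun r hr r' hr' => hr.2.2.trans hr'.2.2.symm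
  no_eps_of_empty j q := by
    simp [decodeTop, activeBuffer, consume, M.no_eps_of_empty]

/-- An `ε`-move exists exactly when the buffer is nonempty or `M` has an `ε`-move, and a letter is
loaded otherwise. If the buffer is nonempty and `M` has no `ε`-move, totality of `M` lets it read
the first buffered letter. -/
theorem transduce_isDet (M : NondetMultipassAutomaton B Q Γ m) (T : Transducer A B P)
    (hT : ∀ p a, (T.out p a).length ≤ n) (hM : M.IsDet) : (M.transduce T hT).IsDet := by
  have eps : ∀ j s γ, (M.transduce T hT).δ j s none γ = ∅ ↔
      (activeBuffer γ s.2.1).1 = [] ∧ M.δ j s.2.2 none (decodeTop γ) = ∅ := by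
    rintro j ⟨p, b, q⟩ γ
    simp only [transduce, Set.union_empty_iff, Set.image_eq_empty]
    rw [and_comm]
    refine and_congr_left fun h => ?_
    rcases activeBuffer γ b with ⟨_ | ⟨x, b⟩, hb⟩
    · simp [consume]
    · have := (hM.total j q (decodeTop γ)).resolve_left (by simp [h]) x
      simp [consume, this.ne_empty]
  have read : ∀ j s γ a, ((M.transduce T hT).δ j s (some a) γ).Nonempty ↔
      (activeBuffer γ s.2.1).1 = [] ∧ M.δ j s.2.2 none (decodeTop γ) = ∅ := by
    intro j s γ a
    exact ⟨fun ⟨_, h⟩ => ⟨h.1, h.2.1 hM⟩, fun h => ⟨_, h.1, fun _ => h.2, rfl⟩⟩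
  refine ⟨?_, ?_, ?_, ?_, ?_, ?_⟩
  · rintro j ⟨p, b, q⟩ (_ | a) γ
    · have h1 := (hM.δ_subsingleton j q none (decodeTop γ)).image
        (fun r : Q × List Γ => ((p, b, r.1), encodeWord γ r.2))
      simp only [transduce]
      rcases activeBuffer γ b with ⟨_ | ⟨x, b'⟩, hb⟩
      · simpa only [consume, Set.union_empty] using h1
      · by_cases h : (M.δ j q none (decodeTop γ)).Nonempty
        · simpa only [consume, hM.deterministic _ _ _ h, Set.image_empty, Set.union_empty] using h1
        · rw [Set.not_nonempty_iff_eq_empty.1 h, Set.image_empty, Set.empty_union]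
          exact (hM.δ_subsingleton _ _ _ _).image _
    · exact fun r hr r' hr' => hr.2.2.trans hr'.2.2.symm
  · intro j s γ h a
    by_contra h'
    rw [← ne_eq, ← Set.nonempty_iff_ne_empty, read, ← eps] at h'
    exact h.ne_empty h'
  · intro j s γ
    simp only [read]
    rw [← eps, Set.nonempty_iff_ne_empty]
    by_cases h : (M.transduce T hT).δ j s none γ = ∅
    · exact .inr fun _ => h
    · exact .inl h
  · rintro j ⟨p, b, q⟩ γ _ ⟨_, q₁, h₁, rfl⟩ _ ⟨_, q₂, h₂, rfl⟩
    rw [hM.nextPass_subsingleton _ _ _ h₁ h₂]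
  · intro j s γ
    rw [eps, ← hM.nextPass_nonempty_iff]
    exact ⟨fun ⟨_, h, q', hq', _⟩ => ⟨h, q', hq'⟩, fun ⟨h, q', hq'⟩ => ⟨_, h, q', hq', rfl⟩⟩
  · intro s γ h
    rw [eps]
    simp only [transduce, Bool.and_eq_true, List.isEmpty_iff] at h
    exact ⟨h.1.1, hM.final_eps _ _ h.2⟩

/-- The stack `s'` of `transduce` represents the stack `s` of the simulated automaton, where `b` is
the content of the buffer. -/
def StackRel (b : List B) (s : List Γ) (s' : List (Option Γ ⊕ A)) : Prop :=
  -- The unmarked empty stack occurs at the start of a pass, before the first letter is loaded.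
  s' = [] ∧ s = [] ∧ b = [] ∨ s' = s.map (fun c => Sum.inl (some c)) ++ [Sum.inl none]

namespace StackRel

variable {b : List B} {s : List Γ} {s' : List (Option Γ ⊕ A)}

theorem decodeTop_head? (h : StackRel b s s') : decodeTop s'.head? = s.head? := by
  rcases h with ⟨rfl, rfl, _⟩ | rfl
  · rfl
  · cases s <;> rfl

theorem activeBuffer_head? {b : {b : List B // b.length ≤ n}} (h : StackRel b.1 s s') :
    activeBuffer s'.head? b = b := by
  rcases h with ⟨rfl, _, hb⟩ | rfl
  · exact Subtype.ext hb.symm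
  · cases s <;> rfl

theorem getD_head? (h : StackRel b s s') (b' : List B) :
    StackRel b' s ([s'.head?.getD (Sum.inl none)] ++ s'.tail) := by
  rcases h with ⟨rfl, rfl, _⟩ | rfl
  · exact .inr rfl
  · cases s <;> exact .inr rfl

theorem encodeWord_append (h : StackRel b s s') (hne : s ≠ [] ∨ b ≠ []) (b' : List B)
    (ζ : List Γ) : StackRel b' (ζ ++ s.tail) (encodeWord s'.head? ζ ++ s'.tail) := by
  rcases h with ⟨rfl, rfl, rfl⟩ | rfl
  · simp at hne
  · right
    cases s <;> simp [encodeWord, decodeTop]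

end StackRel

theorem ne_nil_of_eps (M : NondetMultipassAutomaton B Q Γ m) {j q} {s : List Γ} {r}
    (h : r ∈ M.δ j q none s.head?) : s ≠ [] := by
  rintro rfl
  rw [List.head?_nil, M.no_eps_of_empty] at h
  exact h

/-- The unread input of `M` is `b ++ T.output p u`. Loading a letter leaves it unchanged, and every
other move projects to a move of `M`. -/
theorem accepting_of_transduce (M : NondetMultipassAutomaton B Q Γ m) (T : Transducer A B P)
    (hT : ∀ p a, (T.out p a).length ≤ n) {w : List A} {c}
    (h : Relation.ReflTransGen ((M.transduce T hT).Step w) c (.halt true)) :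
    ∀ j p b q u s s', c = .run j (p, b, q) u s' → StackRel b.1 s s' →
      T.run p u = T.run T.start w → T.accept (T.run T.start w) = true ∧
      Relation.ReflTransGen (M.Step (T.output T.start w)) (.run j q (b.1 ++ T.output p u) s)
        (.halt true) := by
  -- Excluding `.halt false` records the verdict, which the last move of the run needs.
  refine accepting_induction _ (P := fun c => (c ≠ .halt false) ∧
    ∀ j p b q u s s', c = .run j (p, b, q) u s' → StackRel b.1 s s' →
      T.run p u = T.run T.start w → T.accept (T.run T.start w) = true ∧
      Relation.ReflTransGen (M.Step (T.output T.start w)) (.run j q (b.1 ++ T.output p u) s)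
        (.halt true)) ⟨by simp, by simp⟩ ?_ h |>.2
  intro c c' hstep ih
  refine ⟨by rintro rfl; exact (nomatch hstep), ?_⟩
  rintro j p b q u s s' rfl hs hp
  obtain ⟨hne, ih⟩ := ih
  cases hstep with
  | read _ _ q' a u _ ζ h =>
    obtain ⟨hb, -, hq⟩ := h
    rw [hs.activeBuffer_head?] at hb
    cases hq
    have := ih _ _ _ _ _ s _ rfl (hs.getD_head? _) hp
    rwa [hb]
  | eps _ _ q' _ _ ζ h =>
    rcases h with ⟨⟨q', ζ⟩, h, he⟩ | h
    · cases he
      rw [hs.decodeTop_head?] at h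
      have := ih _ _ _ _ _ _ _ rfl (hs.encodeWord_append (.inl (M.ne_nil_of_eps h)) _ _) hp
      exact ⟨this.1, .head (.eps _ _ _ _ _ _ h) this.2⟩
    · rw [hs.activeBuffer_head?] at h
      rcases b with ⟨_ | ⟨x, b⟩, hb⟩
      · exact h.elim
      · obtain ⟨⟨q', ζ⟩, h, he⟩ := h
        cases he
        simp only [hs.decodeTop_head?] at h
        have := ih _ _ _ _ _ _ _ rfl (hs.encodeWord_append (.inr (by simp)) _ _) hp
        exact ⟨this.1, .head (.read _ _ _ _ _ _ _ h) this.2⟩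
  | nextPass j _ q' _ h =>
    obtain ⟨hb, q', hq', rfl⟩ := h
    simp only [hs.activeBuffer_head?, hs.decodeTop_head?] at hb hq'
    have := ih _ _ _ _ _ [] _ rfl (.inl ⟨rfl, rfl, rfl⟩) rfl
    refine ⟨this.1, ?_⟩
    rw [hb]
    exact .head (.nextPass _ _ _ _ hq') this.2
  | final _ _ =>
    have h : (M.transduce T hT).final (p, b, q) s'.head? = true := by
      by_contra h
      simp [h] at hne
    simp only [transduce, Bool.and_eq_true, List.isEmpty_iff, hs.activeBuffer_head?,
      hs.decodeTop_head?] at h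
    refine ⟨by rw [← hp]; exact h.1.2, ?_⟩
    have := Step.final (M := M) (w := T.output T.start w) q s
    rw [h.2] at this
    rw [h.1.1]
    exact .single this

/-- Since `T` may write empty words, several letters may have to be loaded before the buffer becomes
nonempty or the input ends. -/
theorem transduce_load (M : NondetMultipassAutomaton B Q Γ m) (T : Transducer A B P)
    (hT : ∀ p a, (T.out p a).length ≤ n) {w : List A} (j : Fin (m + 1)) (q : Q) (s : List Γ)
    (hM : M.IsDet → M.δ j q none s.head? = ∅) (u : List A) :
    ∀ p b s', StackRel b.1 s s' → ∃ p₁ b₁ u₁ s₁, StackRel b₁.1 s s₁ ∧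
      b₁.1 ++ T.output p₁ u₁ = b.1 ++ T.output p u ∧ T.run p₁ u₁ = T.run p u ∧
      (b₁.1 = [] → u₁ = []) ∧
      Relation.ReflTransGen ((M.transduce T hT).Step w) (.run j (p, b, q) u s')
        (.run j (p₁, b₁, q) u₁ s₁) := by
  induction u with
  | nil => exact fun p b s' hs => ⟨p, b, [], s', hs, rfl, rfl, fun _ => rfl, .refl⟩
  | cons a u ih =>
    intro p b s' hs
    by_cases hb : b.1 = []
    · obtain ⟨p₁, b₁, u₁, s₁, h₁, h₂, h₃, h₄, h₅⟩ := ih (T.step p a) ⟨T.out p a, hT p a⟩ _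
        (hs.getD_head? _)
      refine ⟨p₁, b₁, u₁, s₁, h₁, ?_, h₃, h₄, .head (.read _ _ _ _ _ _ _ ⟨?_, ?_, rfl⟩) h₅⟩
      · rw [h₂, hb]
        rfl
      · rw [hs.activeBuffer_head?, hb]
      · rwa [hs.decodeTop_head?]
    · exact ⟨p, b, a :: u, s', hs, rfl, rfl, fun h => (hb h).elim, .refl⟩

/-- Before `M` reads a letter or the end-marker, letters are loaded as far as necessary. In the
deterministic case this is allowed because such a move of `M` excludes an `ε`-move. -/
theorem transduce_accepting (M : NondetMultipassAutomaton B Q Γ m) (T : Transducer A B P)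
    (hT : ∀ p a, (T.out p a).length ≤ n) {w : List A}
    (hw : T.accept (T.run T.start w) = true) {c}
    (h : Relation.ReflTransGen (M.Step (T.output T.start w)) c (.halt true)) :
    ∀ j p b q u s s', c = .run j q (b.1 ++ T.output p u) s → StackRel b.1 s s' →
      T.run p u = T.run T.start w →
      Relation.ReflTransGen ((M.transduce T hT).Step w) (.run j (p, b, q) u s') (.halt true) := by
  refine accepting_induction _ (P := fun c => (c ≠ .halt false) ∧
    ∀ j p b q u s s', c = .run j q (b.1 ++ T.output p u) s → StackRel b.1 s s' →
      T.run p u = T.run T.start w →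
      Relation.ReflTransGen ((M.transduce T hT).Step w) (.run j (p, b, q) u s') (.halt true))
    ⟨by simp, by simp⟩ ?_ h |>.2
  intro c c' hstep ih
  refine ⟨by rintro rfl; exact (nomatch hstep), ?_⟩
  rintro j p b q u s s' hc hs hp
  obtain ⟨hne, ih⟩ := ih
  cases hstep with
  | read _ _ q' x v _ ζ h =>
    simp only [MultipassConfig.run.injEq] at hc
    obtain ⟨rfl, rfl, hv, rfl⟩ := hc
    obtain ⟨p₁, ⟨b₁, hb₁⟩, u₁, s₁, h₁, h₂, h₃, h₄, h₅⟩ := M.transduce_load T hT (w := w) _ _ _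
      (fun hM => by
        by_contra hn
        have := hM.deterministic _ _ _ (Set.nonempty_iff_ne_empty.2 hn) x
        rw [this] at h
        exact h) u p b s' hs
    refine h₅.trans ?_
    rw [← hv] at h₂
    rcases b₁ with _ | ⟨y, b₁⟩
    · obtain rfl := h₄ rfl
      cases h₂
    · obtain ⟨rfl, rfl⟩ := List.cons_eq_cons.1 h₂
      refine .head (.eps _ _ _ _ _ _ (.inr ?_)) (ih _ _ ⟨b₁, (Nat.le_succ _).trans hb₁⟩ _ _ _ _ rfl
        (h₁.encodeWord_append (.inr (by simp)) b₁ ζ) (h₃.trans hp))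
      rw [h₁.activeBuffer_head?]
      refine ⟨(q', ζ), ?_, rfl⟩
      rwa [h₁.decodeTop_head?]
  | eps _ _ q' v _ ζ h =>
    simp only [MultipassConfig.run.injEq] at hc
    obtain ⟨rfl, rfl, rfl, rfl⟩ := hc
    refine .head (.eps _ _ _ _ _ _ (.inl ⟨(q', ζ), ?_, rfl⟩)) (ih _ _ _ _ _ _ _ rfl
      (hs.encodeWord_append (.inl (M.ne_nil_of_eps h)) _ ζ) hp)
    rwa [hs.decodeTop_head?]
  | nextPass j _ q' _ h =>
    simp only [MultipassConfig.run.injEq] at hc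
    obtain ⟨rfl, rfl, hv, rfl⟩ := hc
    obtain ⟨p₁, ⟨b₁, hb₁⟩, u₁, s₁, h₁, h₂, h₃, h₄, h₅⟩ := M.transduce_load T hT (w := w) _ _ _
      (fun hM => (hM.nextPass_nonempty_iff _ _ _).1 ⟨_, h⟩) u p b s' hs
    refine h₅.trans ?_
    rw [← hv, List.append_eq_nil_iff] at h₂
    obtain ⟨rfl, -⟩ := h₂
    obtain rfl := h₄ rfl
    refine .head (.nextPass _ _ _ _ ⟨?_, q', ?_, rfl⟩) (ih _ _ _ _ _ _ _ rfl
      (.inl ⟨rfl, rfl, rfl⟩) rfl)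
    · rw [h₁.activeBuffer_head?]
    · rwa [h₁.decodeTop_head?]
  | final q₀ _ =>
    simp only [MultipassConfig.run.injEq] at hc
    obtain ⟨rfl, rfl, hv, rfl⟩ := hc
    have hf := (Bool.eq_false_or_eq_true _).resolve_right fun h =>
      hne (congrArg MultipassConfig.halt h)
    obtain ⟨p₁, ⟨b₁, hb₁⟩, u₁, s₁, h₁, h₂, h₃, h₄, h₅⟩ := M.transduce_load T hT (w := w) _ _ _
      (fun hM => hM.final_eps _ _ hf) u p b s' hs
    refine h₅.trans ?_
    rw [← hv, List.append_eq_nil_iff] at h₂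
    obtain ⟨rfl, -⟩ := h₂
    obtain rfl := h₄ rfl
    have hp₁ : T.accept p₁ = true := by
      rw [← hw, ← hp, ← h₃]
      rfl
    have := Step.final (M := M.transduce T hT) (w := w) (p₁, ⟨[], hb₁⟩, q₀) s₁
    rw [show (M.transduce T hT).final (p₁, ⟨[], hb₁⟩, q₀) s₁.head? = true by
      simp [transduce, h₁.activeBuffer_head?, h₁.decodeTop_head?, hf, hp₁]] at this
    exact .single this

theorem language_transduce (M : NondetMultipassAutomaton B Q Γ m) (T : Transducer A B P)
    (hT : ∀ p a, (T.out p a).length ≤ n) :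
    (M.transduce T hT).language = T.preimage M.language := by
  ext w
  constructor
  · intro h
    exact M.accepting_of_transduce T hT h _ _ _ _ _ [] _ rfl (.inl ⟨rfl, rfl, rfl⟩) rfl
  · intro h
    exact M.transduce_accepting T hT h.1 h.2 _ _ ⟨[], _⟩ _ _ [] _ rfl (.inl ⟨rfl, rfl, rfl⟩) rfl

end NondetMultipassAutomaton

/-- This bound keeps the buffer, and with it the state set of `transduce`, finite. -/
theorem Transducer.exists_length_out_le {A B P : Type*} [Finite A] [Finite P]
    (T : Transducer A B P) : ∃ n, ∀ p a, (T.out p a).length ≤ n := by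
  obtain ⟨n, hn⟩ := (Set.finite_range fun r : P × A => (T.out r.1 r.2).length).bddAbove
  exact ⟨n, fun p a => hn ⟨(p, a), rfl⟩⟩

theorem IsNondetMultipass.preimage {A B P : Type} [Finite A] [Finite B] [Finite P]
    {L : Language B} (hL : IsNondetMultipass L) (T : Transducer A B P) :
    IsNondetMultipass (T.preimage L) := by
  obtain ⟨m, Q, Γ, hQ, hΓ, M, rfl⟩ := hL
  obtain ⟨n, hT⟩ := T.exists_length_out_le
  have := (List.finite_length_le B n).to_subtype
  exact ⟨m, _, _, inferInstanceAs (Finite (P × {b : List B | b.length ≤ n} × Q)), inferInstance,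
    M.transduce T hT, M.language_transduce T hT⟩

theorem IsDetMultipass.preimage {A B P : Type} [Finite A] [Finite B] [Finite P]
    {L : Language B} (hL : IsDetMultipass L) (T : Transducer A B P) :
    IsDetMultipass (T.preimage L) := by
  obtain ⟨m, Q, Γ, hQ, hΓ, M, hM, rfl⟩ := (isDetMultipass_iff L).1 hL
  obtain ⟨n, hT⟩ := T.exists_length_out_le
  have := (List.finite_length_le B n).to_subtype
  exact (isDetMultipass_iff _).2 ⟨m, _, _,
    inferInstanceAs (Finite (P × {b : List B | b.length ≤ n} × Q)), inferInstance,
    M.transduce T hT, M.transduce_isDet T hT hM, M.language_transduce T hT⟩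

/-! ### Intersection with a real-time pushdown language by an additional pass -/

/-- A pushdown automaton which reads its input once and moves only when reading a letter, by a
total transition function. -/
structure RealTimePushdown (A Q Γ : Type*) where
  /-- the initial state -/
  start : Q
  /-- the new state and the word that replaces the top letter of the stack -/
  next : Q → A → Option Γ → Q × List Γ
  /-- the acceptance condition, on the state and the top letter of the stack -/
  accept : Q → Option Γ → Bool

namespace RealTimePushdown

variable {A Q Γ : Type*}

/-- The effect of reading a letter on the state and the stack. -/
def move (K : RealTimePushdown A Q Γ) (c : Q × List Γ) (a : A) : Q × List Γ :=
  ((K.next c.1 a c.2.head?).1, (K.next c.1 a c.2.head?).2 ++ c.2.tail)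

/-- Acceptance of a state and a stack. -/
def AcceptsConfig (K : RealTimePushdown A Q Γ) (c : Q × List Γ) : Prop :=
  K.accept c.1 c.2.head? = true

/-- The language accepted by `K`. -/
def language (K : RealTimePushdown A Q Γ) : Language A :=
  {w | K.AcceptsConfig (w.foldl K.move (K.start, []))}

end RealTimePushdown

namespace NondetMultipassAutomaton

variable {A Q R Γ Δ : Type*} {m : ℕ}

/-- The automaton which runs `K` on a first pass and then, if `K` has accepted, runs `M`. -/
def prepend (M : NondetMultipassAutomaton A Q Γ m) (K : RealTimePushdown A R Δ) :
    NondetMultipassAutomaton A (R × Option Q) (Δ ⊕ Γ) (m + 1) where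
  inputToStack := M.inputToStack.trans ⟨Sum.inr, Sum.inr_injective⟩
  start := (K.start, none)
  δ j s σ γ := Fin.cases
    (match σ with
      | none => ∅
      | some a => {(((K.next s.1 a (γ.bind Sum.getLeft?)).1, s.2),
            (K.next s.1 a (γ.bind Sum.getLeft?)).2.map Sum.inl)})
    (fun j => match s.2 with
      | some q => (fun r : Q × List Γ => ((s.1, some r.1), r.2.map Sum.inr)) ''
          M.δ j q σ (γ.bind Sum.getRight?)
      -- After `K` has rejected, the later passes merely read the input, as totality requires, and
      -- `final` rejects.
      | none => {r | σ ≠ none ∧ r = (s, [])}) j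
  nextPass j s γ := Fin.cases
    {(s.1, if K.accept s.1 (γ.bind Sum.getLeft?) then some M.start else none)}
    (fun j => match s.2 with
      | some q => (fun q' => (s.1, some q')) '' M.nextPass j q (γ.bind Sum.getRight?)
      | none => {s}) j
  final s γ := s.2.elim false fun q => M.final q (γ.bind Sum.getRight?)
  finite_δ j s σ γ := by
    obtain ⟨r, s⟩ := s
    refine Fin.cases ?_ (fun j => ?_) j
    · rcases σ with _ | a
      · exact Set.finite_empty
      · exact Set.finite_singleton _
    · rcases s with _ | q
      · exact Set.Subsingleton.finite fun r hr r' hr' => hr.2.trans hr'.2.symm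
      · exact (M.finite_δ _ _ _ _).image _
  no_eps_of_empty j s := by
    obtain ⟨r, s⟩ := s
    refine Fin.cases rfl (fun j => ?_) j
    rcases s with _ | q
    · simp
    · simp [M.no_eps_of_empty]

theorem prepend_isDet (M : NondetMultipassAutomaton A Q Γ m) (K : RealTimePushdown A R Δ)
    (hM : M.IsDet) : (M.prepend K).IsDet := by
  refine ⟨?_, ?_, ?_, ?_, ?_, ?_⟩
  · rintro j ⟨r, s⟩ σ γ
    refine Fin.cases ?_ (fun j => ?_) j
    · rcases σ with _ | a
      · exact Set.subsingleton_empty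
      · exact Set.subsingleton_singleton
    · rcases s with _ | q
      · exact fun r hr r' hr' => hr.2.trans hr'.2.symm
      · exact (hM.δ_subsingleton _ _ _ _).image _
  · rintro j ⟨r, s⟩ γ
    refine Fin.cases ?_ (fun j => ?_) j
    · exact fun h => (Set.not_nonempty_empty h).elim
    · rcases s with _ | q
      · rintro ⟨_, h, _⟩
        exact (h rfl).elim
      · intro h a
        exact Set.image_eq_empty.2 (hM.deterministic _ _ _ (Set.image_nonempty.1 h) a)
  · rintro j ⟨r, s⟩ γ
    refine Fin.cases ?_ (fun j => ?_) j
    · exact .inr fun a => Set.singleton_nonempty _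
    · rcases s with _ | q
      · exact .inr fun a => ⟨_, Option.some_ne_none a, rfl⟩
      · exact (hM.total j q _).imp (fun h => h.image _) (fun h a => (h a).image _)
  · rintro j ⟨r, s⟩ γ
    refine Fin.cases ?_ (fun j => ?_) j
    · exact Set.subsingleton_singleton
    · rcases s with _ | q
      · exact Set.subsingleton_singleton
      · exact (hM.nextPass_subsingleton _ _ _).image _
  · rintro j ⟨r, s⟩ γ
    refine Fin.cases ?_ (fun j => ?_) j
    · exact ⟨fun _ => rfl, fun _ => Set.singleton_nonempty _⟩
    · rcases s with _ | q
      · refine ⟨fun _ => ?_, fun _ => Set.singleton_nonempty _⟩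
        exact Set.eq_empty_of_forall_notMem fun _ h => h.1 rfl
      · exact Set.image_nonempty.trans ((hM.nextPass_nonempty_iff _ _ _).trans
          Set.image_eq_empty.symm)
  · rintro ⟨r, _ | q⟩ γ h
    · cases h
    · exact Set.image_eq_empty.2 (hM.final_eps _ _ h)

theorem bind_getLeft?_head? (s : List Δ) :
    (s.map (Sum.inl : Δ → Δ ⊕ Γ)).head?.bind Sum.getLeft? = s.head? := by
  cases s <;> rfl

theorem bind_getRight?_head? (s : List Γ) :
    (s.map (Sum.inr : Γ → Δ ⊕ Γ)).head?.bind Sum.getRight? = s.head? := by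
  cases s <;> rfl

theorem prepend_read_first (M : NondetMultipassAutomaton A Q Γ m) (K : RealTimePushdown A R Δ)
    {w : List A} (z : Option Q) (u : List A) : ∀ c : R × List Δ,
    Relation.ReflTransGen ((M.prepend K).Step w) (.run 0 (c.1, z) u (c.2.map Sum.inl))
      (.run 0 ((u.foldl K.move c).1, z) [] ((u.foldl K.move c).2.map Sum.inl)) := by
  induction u with
  | nil => exact fun c => .refl
  | cons a u ih =>
    intro c
    refine .head ?_ (ih (K.move c a))
    have := Step.read (M := M.prepend K) (w := w) 0 (c.1, z) _ a u (c.2.map Sum.inl) _ rfl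
    simpa only [bind_getLeft?_head?, RealTimePushdown.move, List.map_append, List.map_tail]
      using this

/-- The property of configurations of `prepend` that characterizes the accepting ones. -/
def PrependAccepting (M : NondetMultipassAutomaton A Q Γ m) (K : RealTimePushdown A R Δ)
    (w : List A) : MultipassConfig A (R × Option Q) (Δ ⊕ Γ) (m + 1) → Prop
  | .halt b => b = true
  | .run j (r, z) u s => Fin.cases
      (∀ s₁, s = s₁.map Sum.inl → K.AcceptsConfig (u.foldl K.move (r, s₁)) ∧ w ∈ M.language)
      (fun j => ∃ q, z = some q ∧ ∀ s₂, s = s₂.map Sum.inr →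
        Relation.ReflTransGen (M.Step w) (.run j q u s₂) (.halt true)) j

theorem prependAccepting_of_step (M : NondetMultipassAutomaton A Q Γ m)
    (K : RealTimePushdown A R Δ) {w : List A} {c c'} (h : (M.prepend K).Step w c c')
    (hc' : M.PrependAccepting K w c') : M.PrependAccepting K w c := by
  cases h with
  | read j q q' a u s ζ h =>
    obtain ⟨r, z⟩ := q
    induction j using Fin.cases with
    | zero =>
      rintro s₁ rfl
      obtain ⟨rfl, rfl⟩ := Prod.mk.inj h
      have h := hc' (K.move (r, s₁) a).2
        (by simp only [bind_getLeft?_head?, RealTimePushdown.move, List.map_append, List.map_tail])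
      rwa [bind_getLeft?_head?] at h
    | succ j =>
      rcases z with _ | q
      · obtain ⟨rfl, rfl⟩ := Prod.mk.inj h.2
        obtain ⟨q, hq, _⟩ := hc'
        cases hq
      · obtain ⟨⟨q', ζ⟩, h, he⟩ := h
        obtain ⟨rfl, rfl⟩ := Prod.mk.inj he
        refine ⟨q, rfl, ?_⟩
        rintro s₂ rfl
        obtain ⟨_, hq, h'⟩ := hc'
        obtain rfl := Option.some.inj hq
        rw [bind_getRight?_head?] at h
        refine .head (.read _ _ _ _ _ _ _ h) (h' _ ?_)
        simp only [List.map_append, List.map_tail]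
  | eps j q q' u s ζ h =>
    obtain ⟨r, z⟩ := q
    induction j using Fin.cases with
    | zero => exact h.elim
    | succ j =>
      rcases z with _ | q
      · exact (h.1 rfl).elim
      · obtain ⟨⟨q', ζ⟩, h, he⟩ := h
        obtain ⟨rfl, rfl⟩ := Prod.mk.inj he
        refine ⟨q, rfl, ?_⟩
        rintro s₂ rfl
        obtain ⟨_, hq, h'⟩ := hc'
        obtain rfl := Option.some.inj hq
        rw [bind_getRight?_head?] at h
        refine .head (.eps _ _ _ _ _ _ h) (h' _ ?_)
        simp only [List.map_append, List.map_tail]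
  | nextPass j q q' s h =>
    obtain ⟨r, z⟩ := q
    induction j using Fin.cases with
    | zero =>
      rintro s₁ rfl
      obtain rfl := h
      obtain ⟨q, hq, h'⟩ := hc'
      simp only [bind_getLeft?_head?, ite_eq_iff, reduceCtorEq, and_false, or_false] at hq
      obtain ⟨ha, hq⟩ := hq
      obtain rfl := Option.some.inj hq
      exact ⟨ha, h' [] rfl⟩
    | succ j =>
      rcases z with _ | q
      · obtain rfl := h
        obtain ⟨q, hq, _⟩ := hc'
        cases hq
      · obtain ⟨q', h, rfl⟩ := h
        refine ⟨q, rfl, ?_⟩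
        rintro s₂ rfl
        obtain ⟨_, hq, h'⟩ := hc'
        obtain rfl := Option.some.inj hq
        rw [bind_getRight?_head?] at h
        exact .head (.nextPass _ _ _ _ h) (h' [] rfl)
  | final q s =>
    obtain ⟨r, _ | q⟩ := q
    · cases hc'
    · refine ⟨q, rfl, ?_⟩
      rintro s₂ rfl
      have h : M.final q s₂.head? = true := by
        rw [← bind_getRight?_head? (Δ := Δ)]
        exact hc'
      have := Step.final (M := M) (w := w) q s₂
      rw [h] at this
      exact .single this

theorem prepend_accepting (M : NondetMultipassAutomaton A Q Γ m) (K : RealTimePushdown A R Δ)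
    {w : List A} (r : R) {c} (h : Relation.ReflTransGen (M.Step w) c (.halt true)) :
    ∀ j q u s, c = .run j q u s → Relation.ReflTransGen ((M.prepend K).Step w)
      (.run j.succ (r, some q) u (s.map Sum.inr)) (.halt true) := by
  refine accepting_induction _ (P := fun c => c ≠ .halt false ∧ ∀ j q u s, c = .run j q u s →
    Relation.ReflTransGen ((M.prepend K).Step w) (.run j.succ (r, some q) u (s.map Sum.inr))
      (.halt true)) ⟨by simp, by simp⟩ ?_ h |>.2
  intro c c' hstep ih
  refine ⟨by rintro rfl; exact (nomatch hstep), ?_⟩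
  rintro j q u s rfl
  obtain ⟨hne, ih⟩ := ih
  cases hstep with
  | read _ _ q' a u _ ζ h =>
    have h := Step.read (M := M.prepend K) (w := w) j.succ (r, some q) (r, some q') a u
      (s.map Sum.inr) (ζ.map Sum.inr) ⟨(q', ζ), by rwa [bind_getRight?_head?], rfl⟩
    refine .head h ?_
    simpa only [List.map_append, List.map_tail] using ih _ _ _ _ rfl
  | eps _ _ q' _ _ ζ h =>
    have h := Step.eps (M := M.prepend K) (w := w) j.succ (r, some q) (r, some q') u
      (s.map Sum.inr) (ζ.map Sum.inr) ⟨(q', ζ), by rwa [bind_getRight?_head?], rfl⟩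
    refine .head h ?_
    simpa only [List.map_append, List.map_tail] using ih _ _ _ _ rfl
  | nextPass j _ q' _ h =>
    have h := Step.nextPass (M := M.prepend K) (w := w) j.succ (r, some q) (r, some q')
      (s.map Sum.inr) ⟨q', by rwa [bind_getRight?_head?], rfl⟩
    exact .head h (ih _ _ _ _ rfl)
  | final _ _ =>
    have hf := (Bool.eq_false_or_eq_true _).resolve_right fun h =>
      hne (congrArg MultipassConfig.halt h)
    have h := Step.final (M := M.prepend K) (w := w) (r, some q) (s.map Sum.inr)
    rw [show (M.prepend K).final (r, some q) (s.map Sum.inr).head? = true by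
      simp only [prepend, Option.elim, bind_getRight?_head?, hf]] at h
    exact .single h

theorem language_prepend (M : NondetMultipassAutomaton A Q Γ m) (K : RealTimePushdown A R Δ) :
    (M.prepend K).language = {w | w ∈ K.language ∧ w ∈ M.language} := by
  ext w
  constructor
  · intro h
    exact accepting_induction _ (P := M.PrependAccepting K w) rfl
      (fun c c' => M.prependAccepting_of_step K) h [] rfl
  · rintro ⟨h, hw⟩
    refine (M.prepend_read_first K none w (K.start, [])).trans (.head ?_
      (M.prepend_accepting K (w.foldl K.move (K.start, [])).1 hw _ _ _ _ rfl))
    have h' : K.accept (w.foldl K.move (K.start, [])).1 (w.foldl K.move (K.start, [])).2.head? =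
      true := h
    refine .nextPass (0 : Fin (m + 1)) _ _ _ ?_
    change _ = _
    simp only [bind_getLeft?_head?, h', if_true]

end NondetMultipassAutomaton

theorem IsNondetMultipass.inter_realTime {A R Δ : Type} [Finite R] [Finite Δ]
    {L : Language A} (hL : IsNondetMultipass L) (K : RealTimePushdown A R Δ) :
    IsNondetMultipass {w | w ∈ K.language ∧ w ∈ L} := by
  obtain ⟨m, Q, Γ, hQ, hΓ, M, rfl⟩ := hL
  exact ⟨_, _, _, inferInstance, inferInstance, M.prepend K, M.language_prepend K⟩

theorem IsDetMultipass.inter_realTime {A R Δ : Type} [Finite R] [Finite Δ]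
    {L : Language A} (hL : IsDetMultipass L) (K : RealTimePushdown A R Δ) :
    IsDetMultipass {w | w ∈ K.language ∧ w ∈ L} := by
  obtain ⟨m, Q, Γ, hQ, hΓ, M, hM, rfl⟩ := (isDetMultipass_iff L).1 hL
  exact (isDetMultipass_iff _).2 ⟨_, _, _, inferInstance, inferInstance, M.prepend K,
    M.prepend_isDet K hM, M.language_prepend K⟩

/-! ### Words over a semidirect product with a finite group -/

section Words

variable {G : Type*} [Group G]

/-- The value of a letter of a word problem. -/
def letterValue {X : Type*} (x : X → G) (p : X × Bool) : G := if p.2 then x p.1 else (x p.1)⁻¹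

theorem mem_wordProblem {X : Type*} {x : X → G} {w : List (X × Bool)} :
    w ∈ wordProblem x ↔ (w.map (letterValue x)).prod = 1 := Iff.rfl

theorem exists_word_of_closure_eq_top {X : Type*} {x : X → G}
    (hx : Subgroup.closure (Set.range x) = ⊤) (g : G) :
    ∃ v : List (X × Bool), (v.map (letterValue x)).prod = g := by
  have hg : g ∈ Subgroup.closure (Set.range x) := hx ▸ Subgroup.mem_top g
  induction hg using Subgroup.closure_induction_left with
  | one => exact ⟨[], rfl⟩
  | mul_left a ha b _ ih =>
    obtain ⟨i, rfl⟩ := ha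
    obtain ⟨v, rfl⟩ := ih
    exact ⟨(i, true) :: v, rfl⟩
  | inv_mul_cancel a ha b _ ih =>
    obtain ⟨i, rfl⟩ := ha
    obtain ⟨v, rfl⟩ := ih
    exact ⟨(i, false) :: v, rfl⟩

variable {F : Type} [Group F] {ρ : F →* MulAut G} {A B : Type*}

open Classical in
/-- The transducer which computes the `G`-component of the value of a word over elements of a
semidirect product `G ⋊[ρ] F`, written with the words `word g`, and accepts if the `F`-component is
trivial. -/
noncomputable def semidirectTransducer (c : A → G ⋊[ρ] F) (word : G → List B) :
    Transducer A B F where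
  start := 1
  step e a := e * (c a).right
  -- By `(g, e) * (g', e') = (g * ρ e g', e * e')`, a letter contributes its left component twisted
  -- by the `F`-component of the prefix already read.
  out e a := word (ρ e (c a).left)
  accept e := e = 1

theorem accept_semidirectTransducer (c : A → G ⋊[ρ] F) (word : G → List B) (e : F) :
    (semidirectTransducer c word).accept e = true ↔ e = 1 := by
  simp [semidirectTransducer]

theorem run_semidirectTransducer (c : A → G ⋊[ρ] F) (word : G → List B) (w : List A) (e : F) :
    (semidirectTransducer c word).run e w = e * (w.map c).prod.right := by
  induction w generalizing e with
  | nil => simp [Transducer.run]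
  | cons a w ih =>
    rw [Transducer.run, List.foldl_cons, ← Transducer.run, ih]
    simp [semidirectTransducer, mul_assoc]

theorem prod_output_semidirectTransducer (c : A → G ⋊[ρ] F) (word : G → List B) (val : B → G)
    (hword : ∀ g, ((word g).map val).prod = g) (w : List A) (e : F) :
    (((semidirectTransducer c word).output e w).map val).prod = ρ e (w.map c).prod.left := by
  induction w generalizing e with
  | nil => simp [Transducer.output]
  | cons a w ih =>
    rw [Transducer.output, List.map_append, List.prod_append, ih]
    simp [semidirectTransducer, hword]

theorem preimage_semidirectTransducer {X : Type*} {x : X → G} (c : A → G ⋊[ρ] F)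
    (word : G → List (X × Bool)) (hword : ∀ g, ((word g).map (letterValue x)).prod = g) :
    (semidirectTransducer c word).preimage (wordProblem x) = {w | (w.map c).prod = 1} := by
  ext w
  have h : w ∈ (semidirectTransducer c word).preimage (wordProblem x) ↔
      (semidirectTransducer c word).accept ((semidirectTransducer c word).run 1 w) = true ∧
      ((((semidirectTransducer c word).output 1 w).map (letterValue x)).prod = 1) := Iff.rfl
  rw [h, accept_semidirectTransducer, run_semidirectTransducer,
    prod_output_semidirectTransducer c word _ hword, map_one, one_mul, MulAut.one_apply]
  exact ⟨fun h => SemidirectProduct.ext h.2 h.1, fun h => by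
    have h : (w.map c).prod = 1 := h
    simp [h]⟩

end Words

/-! ### Britton reduction modulo a finite-index normal subgroup -/

namespace HNNOfAut

open HNNExtension HNNExtension.NormalWord

variable {G : Type*} [Group G] {S : Subgroup G} {φ : G ≃* G}

theorem mem_toSubgroup_iff (hφS : S.map (φ : G →* G) = S) (u : ℤˣ) (g : G) :
    g ∈ toSubgroup S (S.map (φ : G →* G)) u ↔ g ∈ S := by
  rcases Int.units_eq_one_or u with rfl | rfl
  · rfl
  · rw [toSubgroup_neg_one, hφS]

theorem t_zpow_mul_of (hφS : S.map (φ : G →* G) = S) (u : ℤˣ) {g : G} (hg : g ∈ S) :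
    (t ^ (u : ℤ) * of g : HNNOfAut S φ) = of (((φ : MulAut G) ^ (u : ℤ)) g) * t ^ (u : ℤ) := by
  rcases Int.units_eq_one_or u with rfl | rfl
  · simpa using t_mul_of (φ := φ.subgroupMap S) ⟨g, hg⟩
  · rw [← hφS] at hg
    obtain ⟨a, ha, rfl⟩ := hg
    have := inv_t_mul_of (φ := φ.subgroupMap S) ⟨φ a, a, ha, rfl⟩
    have h : (φ.subgroupMap S).symm ⟨φ a, a, ha, rfl⟩ = ⟨a, ha⟩ := by
      rw [MulEquiv.symm_apply_eq]
      rfl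
    rw [h] at this
    simpa using this

variable {F : Type} [Group F] (π : G →* F) (ψ : MulAut F)

/-- The configuration (state and stack) which represents a reduced word. -/
def configOf (w : ReducedWord G S (S.map (φ : G →* G))) : F × List (ℤˣ × F) :=
  (π w.head, w.toList.map (Prod.map id π))

/-- A configuration represents an element if it comes from a reduced word for the element. -/
def Represents (c : F × List (ℤˣ × F)) (h : HNNOfAut S φ) : Prop :=
  ∃ w : ReducedWord G S (S.map (φ : G →* G)), w.prod (φ.subgroupMap S) = h ∧ c = configOf π w

open Classical in
/-- The transition for left multiplication by `t ^ u`. -/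
noncomputable def stableLetterNext (S : Subgroup G) (u : ℤˣ) (q : F) :
    Option (ℤˣ × F) → F × List (ℤˣ × F)
  | none => (1, [(u, q)])
  -- A pinch `t ^ u * g * t ^ (-u)` with `g ∈ S` equals `φ ^ u` applied to `g`; here `q` is the
  -- class of `g`, and `r` that of the element following the removed stable letter.
  | some (v, r) => if v = -u ∧ q ∈ S.map π then ((ψ ^ (u : ℤ)) q * r, [])
      else (1, [(u, q), (v, r)])

theorem represents_of_mul {c : F × List (ℤˣ × F)} {h : HNNOfAut S φ} (hc : Represents π c h)
    (g : G) : Represents π (π g * c.1, c.2) (of g * h) := by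
  obtain ⟨w, rfl, rfl⟩ := hc
  exact ⟨⟨g * w.head, w.toList, w.chain⟩, by simp [ReducedWord.prod, mul_assoc],
    by simp [configOf]⟩

/-- Since `π.ker ≤ S`, the class of `g` decides whether `g ∈ S`, hence whether the new stable letter
cancels. If it does, a tail of a reduced word remains; if not, the longer word is reduced. No choice
of coset representatives is needed, as any reduced word will do. -/
theorem represents_t_zpow_mul (hφS : S.map (φ : G →* G) = S) (hπ : π.ker ≤ S)
    (hψ : ∀ g, π (φ g) = ψ (π g)) {c : F × List (ℤˣ × F)} {h : HNNOfAut S φ}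
    (hc : Represents π c h) (u : ℤˣ) :
    Represents π ((stableLetterNext π ψ S u c.1 c.2.head?).1,
      (stableLetterNext π ψ S u c.1 c.2.head?).2 ++ c.2.tail) (t ^ (u : ℤ) * h) := by
  have hψ' : ∀ g, (ψ ^ (u : ℤ)) (π g) = π (((φ : MulAut G) ^ (u : ℤ)) g) := by
    intro g
    rcases Int.units_eq_one_or u with rfl | rfl
    · simpa using (hψ g).symm
    · have : ψ⁻¹ (π g) = π ((φ : MulAut G)⁻¹ g) := by
        rw [MulAut.inv_apply, MulEquiv.symm_apply_eq, ← hψ, MulAut.inv_def,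
          MulEquiv.apply_symm_apply]
      simpa using this
  have hS : ∀ g, π g ∈ S.map π ↔ g ∈ S := fun g => by
    rw [← Subgroup.mem_comap, Subgroup.comap_map_eq_self hπ]
  obtain ⟨⟨g, L, hL⟩, rfl, rfl⟩ := hc
  rcases L with _ | ⟨⟨v, r⟩, L⟩
  · refine ⟨⟨1, [(u, g)], List.isChain_singleton _⟩, ?_, ?_⟩
    · simp [ReducedWord.prod]
    · simp [configOf, stableLetterNext]
  · change Represents π ((stableLetterNext π ψ S u (π g) (some (v, π r))).1,
      (stableLetterNext π ψ S u (π g) (some (v, π r))).2 ++ L.map (Prod.map id π)) _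
    rw [stableLetterNext]
    split_ifs with hcan
    · obtain ⟨rfl, hg⟩ := hcan
      rw [hS] at hg
      refine ⟨⟨((φ : MulAut G) ^ (u : ℤ)) g * r, L, hL.tail⟩, ?_, ?_⟩
      · have := eq_mul_inv_iff_mul_eq.2 (t_zpow_mul_of hφS u hg).symm
        simp [ReducedWord.prod, this, mul_assoc]
      · simp [configOf, hψ']
    · refine ⟨⟨1, (u, g) :: (v, r) :: L, ?_⟩, ?_, ?_⟩
      · refine List.isChain_cons_cons.2 ⟨fun hg => ?_, hL⟩
        rw [mem_toSubgroup_iff hφS] at hg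
        by_contra hne
        refine hcan ⟨?_, (hS g).2 hg⟩
        rw [← Int.units_ne_iff_eq_neg]
        exact Ne.symm hne
      · simp [ReducedWord.prod, mul_assoc]
      · simp [configOf]

theorem represents_one : Represents π (1, []) (1 : HNNOfAut S φ) :=
  ⟨ReducedWord.empty _ _ _, by simp [ReducedWord.prod], by simp [configOf]⟩

/-- This is Britton's lemma: a reduced word containing a stable letter has its value outside `G`. -/
theorem snd_eq_nil_iff_of_represents {c : F × List (ℤˣ × F)} {h : HNNOfAut S φ}
    (hc : Represents π c h) : c.2 = [] ↔ h ∈ (of : G →* HNNOfAut S φ).range := by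
  obtain ⟨w, rfl, rfl⟩ := hc
  simp only [configOf, List.map_eq_nil_iff]
  refine ⟨fun hw => ⟨w.head, ?_⟩, fun hw => HNNExtension.ReducedWord.toList_eq_nil_of_mem_of_range _ w hw⟩
  simp [ReducedWord.prod, hw]

/-! ### The pushdown automaton for membership in the base group -/

variable {n : ℕ} (y : Fin n → G)

/-- The generators of the HNN-extension: the stable letter and the given elements of `G`. -/
def generators (S : Subgroup G) (φ : G ≃* G) (y : Fin n → G) : Fin (n + 1) → HNNOfAut S φ :=
  Fin.cons t fun i => of (y i)

theorem closure_range_generators (hy : Subgroup.closure (Set.range y) = ⊤) :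
    Subgroup.closure (Set.range (generators S φ y)) = ⊤ := by
  rw [eq_top_iff]
  intro h _
  induction h using HNNExtension.induction_on with
  | of g =>
    have : Subgroup.closure (Set.range y) ≤
        (Subgroup.closure (Set.range (generators S φ y))).comap of := by
      rw [Subgroup.closure_le]
      rintro _ ⟨i, rfl⟩
      exact Subgroup.subset_closure ⟨i.succ, rfl⟩
    rw [hy] at this
    exact this (Subgroup.mem_top g)
  | t => exact Subgroup.subset_closure ⟨0, rfl⟩
  | mul x y hx hy => exact mul_mem (hx trivial) (hy trivial)
  | inv x hx => exact inv_mem (hx trivial)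

/-- The pushdown automaton which computes a representation of the inverse of its input and accepts
the words whose value is in `G`. -/
noncomputable def pushdown (S : Subgroup G) : RealTimePushdown (Fin (n + 1) × Bool) F (ℤˣ × F) where
  start := 1
  -- The top of the stack is the left end of the reduced word, so letters act by left
  -- multiplication. Multiplying by their inverses accumulates the inverse of the input, which lies
  -- in `G` exactly when the input does; hence `t` acts with exponent `-1`.
  next q p γ := Fin.cases (stableLetterNext π ψ S (if p.2 then -1 else 1) q γ)
    (fun i => ((π (letterValue y (i, p.2)))⁻¹ * q, γ.toList)) p.1
  accept _ γ := γ.isNone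

theorem represents_foldl_move (hφS : S.map (φ : G →* G) = S) (hπ : π.ker ≤ S)
    (hψ : ∀ g, π (φ g) = ψ (π g)) (w : List (Fin (n + 1) × Bool)) :
    ∀ (c : F × List (ℤˣ × F)) (h : HNNOfAut S φ), Represents π c h →
      Represents π (w.foldl (pushdown π ψ y S).move c)
        ((w.map (letterValue (generators S φ y))).prod⁻¹ * h) := by
  induction w with
  | nil => simp
  | cons p w ih =>
    intro c h hc
    rw [List.foldl_cons, List.map_cons, List.prod_cons, mul_inv_rev, mul_assoc]
    refine ih _ _ ?_
    obtain ⟨i, b⟩ := p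
    induction i using Fin.cases with
    | zero =>
      have := represents_t_zpow_mul π ψ hφS hπ hψ hc (if b then -1 else 1)
      have ht : (letterValue (generators S φ y) (0, b))⁻¹ =
          t ^ (((if b then -1 else 1 : ℤˣ)) : ℤ) := by
        cases b <;> simp [letterValue, generators]
      rw [ht]
      exact this
    | succ i =>
      have := represents_of_mul π hc (letterValue y (i, b))⁻¹
      have hv : (letterValue (generators S φ y) (i.succ, b))⁻¹ = of (letterValue y (i, b))⁻¹ := by
        cases b <;> simp [letterValue, generators]
      rw [hv]
      rw [map_inv] at this
      rcases c with ⟨q, _ | ⟨a, s⟩⟩ <;> exact this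

theorem mem_language_pushdown_iff (hφS : S.map (φ : G →* G) = S) (hπ : π.ker ≤ S)
    (hψ : ∀ g, π (φ g) = ψ (π g)) (w : List (Fin (n + 1) × Bool)) :
    w ∈ (pushdown π ψ y S).language ↔
      (w.map (letterValue (generators S φ y))).prod ∈ (of : G →* HNNOfAut S φ).range := by
  have h := represents_foldl_move π ψ y hφS hπ hψ w _ _ (represents_one π)
  rw [mul_one] at h
  rw [← inv_mem_iff, ← snd_eq_nil_iff_of_represents π h]
  change Option.isNone _ = true ↔ _
  rw [Option.isNone_iff_eq_none, List.head?_eq_none_iff]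
  rfl

/-! ### Finite data from `S` and `φ`, and the conclusion -/

/-- The quotient by the normal core of `S` works: an automorphism preserving `S` maps the core to a
normal subgroup inside `S`, hence into the core, and applying this to `φ` and its inverse gives
equality. -/
theorem exists_finite_quotient (hS : S.FiniteIndex) (hφS : S.map (φ : G →* G) = S) :
    ∃ (F : Type) (_ : Group F) (_ : Finite F) (π : G →* F) (ψ : MulAut F),
      π.ker ≤ S ∧ ∀ g, π (φ g) = ψ (π g) := by
  have le : ∀ χ : G ≃* G, S.map (χ : G →* G) = S →
      S.normalCore.map (χ : G →* G) ≤ S.normalCore := by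
    intro χ hχ
    have := S.normalCore_normal.map (χ : G →* G) χ.surjective
    rw [Subgroup.normal_le_normalCore]
    exact (Subgroup.map_mono S.normalCore_le).trans hχ.le
  have hN : S.normalCore.map (φ : G →* G) = S.normalCore := by
    refine le_antisymm (le φ hφS) ?_
    have := le φ.symm ((Subgroup.map_symm_eq_iff_map_eq S).2 hφS)
    intro g hg
    exact ⟨φ.symm g, this ⟨g, hg, rfl⟩, φ.apply_symm_apply g⟩
  have : Finite (G ⧸ S.normalCore) := inferInstance
  -- The quotient is finite and can be moved to `Type`, where the states of an automaton have to
  -- live.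
  let e : Shrink.{0} (G ⧸ S.normalCore) ≃* G ⧸ S.normalCore := Shrink.mulEquiv
  refine ⟨Shrink.{0} (G ⧸ S.normalCore), inferInstance, inferInstance,
    (e.symm : _ →* _).comp (QuotientGroup.mk' S.normalCore),
    (e.trans (QuotientGroup.congr _ _ φ hN)).trans e.symm, ?_, fun g => ?_⟩
  · intro g hg
    have : e.symm (QuotientGroup.mk' S.normalCore g) = 1 := hg
    rw [map_eq_one_iff _ e.symm.injective] at this
    exact S.normalCore_le ((QuotientGroup.eq_one_iff g).1 this)
  · simp

/-- The finite order of `φ` makes `⟨φ⟩` a finite group, which serves as the state set of the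
transducer. -/
theorem exists_finite_aut_action (hφ : IsOfFinOrder (φ : MulAut G)) :
    ∃ (F : Type) (_ : Group F) (_ : Finite F) (ρ : F →* MulAut G) (e : F), ρ e = φ := by
  have : Finite (Subgroup.zpowers (φ : MulAut G)) := finite_zpowers.2 hφ
  exact ⟨Shrink.{0} (Subgroup.zpowers (φ : MulAut G)), inferInstance, inferInstance,
    (Subgroup.subtype _).comp
      (Shrink.mulEquiv : Shrink.{0} (Subgroup.zpowers (φ : MulAut G)) ≃* _).toMonoidHom,
    Shrink.mulEquiv.symm ⟨φ, Subgroup.mem_zpowers _⟩, by simp⟩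

/-- The word problem of the HNN-extension is the intersection of a real-time pushdown language and
the preimage of the word problem of the base group under a transducer. -/
theorem exists_wordProblem_generators_eq (hS : S.FiniteIndex) (hφ : IsOfFinOrder (φ : MulAut G))
    (hφS : S.map (φ : G →* G) = S) (hy : Subgroup.closure (Set.range y) = ⊤) :
    ∃ (F P : Type) (_ : Finite F) (_ : Finite P)
      (K : RealTimePushdown (Fin (n + 1) × Bool) F (ℤˣ × F))
      (T : Transducer (Fin (n + 1) × Bool) (Fin n × Bool) P),
      wordProblem (generators S φ y) =
        {w | w ∈ K.language ∧ w ∈ T.preimage (wordProblem y)} := by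
  obtain ⟨F, _, _, π, ψ, hπ, hψ⟩ := exists_finite_quotient hS hφS
  obtain ⟨P, _, _, ρ, e, he⟩ := exists_finite_aut_action hφ
  choose word hword using exists_word_of_closure_eq_top hy
  let θ : HNNOfAut S φ →* G ⋊[ρ] P := HNNExtension.lift SemidirectProduct.inl
    (SemidirectProduct.inr e) fun a => by
      ext
      · simp [he]
      · simp
  refine ⟨F, P, inferInstance, inferInstance, pushdown π ψ y S,
    semidirectTransducer (fun p => θ (letterValue (generators S φ y) p)) word, ?_⟩
  rw [preimage_semidirectTransducer _ word hword]
  ext w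
  have key : (w.map fun p => θ (letterValue (generators S φ y) p)).prod =
      θ (w.map (letterValue (generators S φ y))).prod := by
    rw [map_list_prod, List.map_map]
    rfl
  change _ ↔ w ∈ (pushdown π ψ y S).language ∧
    (w.map fun p => θ (letterValue (generators S φ y) p)).prod = 1
  rw [mem_language_pushdown_iff π ψ y hφS hπ hψ, key, mem_wordProblem]
  constructor
  · intro h
    rw [h]
    exact ⟨one_mem _, map_one _⟩
  -- On `G` the map `θ` is the inclusion into the semidirect product, so an element of `G` with
  -- trivial image is trivial.
  · rintro ⟨⟨g, hg⟩, h⟩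
    rw [← hg] at h ⊢
    have : SemidirectProduct.inl g = (1 : G ⋊[ρ] P) := by simpa [θ] using h
    rw [(map_eq_one_iff _ SemidirectProduct.inl_injective).1 this, map_one]

end HNNOfAut

theorem mainTheorem2 {G : Type*} [Group G] (S : Subgroup G) (hS : S.FiniteIndex)
    (φ : G ≃* G) (hφ : IsOfFinOrder (φ : MulAut G)) (hφS : S.map (φ : G →* G) = S) :
    (InBDG G → InBDG (HNNOfAut S φ)) ∧ (InPG G → InPG (HNNOfAut S φ)) := by
  constructor
  · rintro ⟨n, y, hy, hL⟩
    obtain ⟨F, P, _, _, K, T, h⟩ := HNNOfAut.exists_wordProblem_generators_eq y hS hφ hφS hy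
    refine ⟨n + 1, HNNOfAut.generators S φ y, HNNOfAut.closure_range_generators y hy, ?_⟩
    rw [h]
    exact (hL.preimage T).inter_realTime K
  · rintro ⟨n, y, hy, hL⟩
    obtain ⟨F, P, _, _, K, T, h⟩ := HNNOfAut.exists_wordProblem_generators_eq y hS hφ hφS hy
    refine ⟨n + 1, HNNOfAut.generators S φ y, HNNOfAut.closure_range_generators y hy, ?_⟩
    rw [h]
    exact (hL.preimage T).inter_realTime K
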